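/- Let $m, n$ be non-negative integers and let $H$ be a random $m\times n$ matrix with independent entries, each with the zero-mean unit-variance circularly symmetric complex Gaussian distribution (that is, with independent real and imaginary parts, each a centred real Gaussian of variance $1/2$). For a positive semidefinite Hermitian $n\times n$ matrix $K$ and a deterministic complex $m\times n$ matrix $D$ put $$I(K,D)=\mathbb{E}\left[\log\det\left(I_m+(H+D)\,K\,(H+D)^*\right)\right],$$ where $\log$ is the natural logarithm and $^*$ denotes the Hermitian conjugate; this expectation exists and is finite. Let $D$ and $\tilde D$ be deterministic complex $m\times n$ matrices such that $D^*D-\tilde D^*\tilde D$ is positive semidefinite. Then $$I(K,D)\ \ge\ I(K,\tilde D)\qquad\text{for every positive semidefinite Hermitian } n\times n \text{ matrix } K.$$ -/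

import Mathlib

open MeasureTheory ProbabilityTheory Matrix
open scoped ComplexOrder

noncomputable section

/-- The zero-mean unit-variance circularly symmetric complex Gaussian law on `ℂ`: the law of
`X + iY` with `X`, `Y` independent real centred Gaussians of variance `1 / 2` each. -/
def stdComplexGaussian : Measure ℂ :=
  ((gaussianReal 0 (1 / 2)).prod (gaussianReal 0 (1 / 2))).map
    fun p : ℝ × ℝ => (p.1 : ℂ) + (p.2 : ℂ) * Complex.I

/-- `H` is a random `m × n` matrix with independent entries, each of which is a zero-mean
unit-variance circularly symmetric complex Gaussian. -/
structure IsStdComplexGaussianMatrix {Ω : Type*} [MeasurableSpace Ω] {m n : ℕ}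
    (H : Ω → Matrix (Fin m) (Fin n) ℂ) (P : Measure Ω) : Prop where
  hasLaw : ∀ i j, HasLaw (fun ω => H ω i j) stdComplexGaussian P
  indep : iIndepFun (fun (p : Fin m × Fin n) ω => H ω p.1 p.2) P

/-- `log det (I_m + G K Gᴴ)` with the natural logarithm. For positive semidefinite `K` the
determinant is a positive real number (see `det_one_add_pos`), so it equals its real part. -/
def logDetRate {m n : ℕ} (K : Matrix (Fin n) (Fin n) ℂ) (G : Matrix (Fin m) (Fin n) ℂ) : ℝ :=
  Real.log (1 + G * K * Gᴴ).det.re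

/-- In the order of `ℂ`, `0 < z` says that `z` is real and positive. -/
theorem det_one_add_pos {m n : ℕ} {K : Matrix (Fin n) (Fin n) ℂ} (hK : K.PosSemidef)
    (G : Matrix (Fin m) (Fin n) ℂ) : 0 < (1 + G * K * Gᴴ).det :=
  (PosDef.one.add_posSemidef (hK.mul_mul_conjTranspose_same G)).det_pos

/-- The average Gaussian input information rate
`I(K, D) = E[log det (I_m + (H + D) K (H + D)ᴴ)]`. -/
def gaussianRate {Ω : Type*} [MeasurableSpace Ω] {m n : ℕ} (P : Measure Ω)
    (H : Ω → Matrix (Fin m) (Fin n) ℂ) (K : Matrix (Fin n) (Fin n) ℂ)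
    (D : Matrix (Fin m) (Fin n) ℂ) : ℝ :=
  ∫ ω, logDetRate K (H ω + D) ∂P

end

/-! The hypothesis on the Gram matrices says that `D'` is a contraction times `D`, hence `D' = U *
diag(r) * V * D` with `U`, `V` unitary and `0 ≤ r i ≤ 1` (`Matrix.exists_unitary_diagonal_unitary`).
The Gaussian law and the log-determinant are both invariant under left multiplication by a unitary,
so it remains to see that shrinking the rows of the mean lowers the rate.

Rows are shrunk one at a time. With the others frozen, the determinant is a positive constant plus a
positive semidefinite form in the row (`Matrix.PosSemidef.exists_det_one_add_updateRow_eq`), so the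
claim becomes Anderson's inequality for increasing functions of such a form. Unitary invariance
diagonalizes the form, and freezing all but one real coordinate leaves dimension one, where a
reflection argument applies (`lintegral_gaussianReal_add_mono`).

Comparisons are made with `lintegral`, where no integrability is needed; the bound `log det (1 + M)
≤ tr M` supplies it at the end. -/

/-! ### Product measures, one coordinate at a time -/

theorem lintegral_pi_le_of_lintegral_update_le {ι : Type*} [Fintype ι] [DecidableEq ι]
    {α : ι → Type*} [∀ i, MeasurableSpace (α i)] {μ : ∀ i, Measure (α i)} [∀ i, SigmaFinite (μ i)]
    (i : ι) {f g : (∀ i, α i) → ENNReal} (hf : Measurable f) (hg : Measurable g)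
    (h : ∀ x, ∫⁻ y, f (Function.update x i y) ∂μ i ≤ ∫⁻ y, g (Function.update x i y) ∂μ i) :
    ∫⁻ x, f x ∂Measure.pi μ ≤ ∫⁻ x, g x ∂Measure.pi μ := by
  refine lintegral_le_of_lmarginal_le {i} hf hg ?_
  rw [lmarginal_singleton, lmarginal_singleton]
  exact h

/-- If shifting any single coordinate by `b i` instead of `a i` does not increase the integral,
neither does shifting all coordinates simultaneously. -/
theorem lintegral_pi_add_le_of_forall_update {ι : Type*} [Fintype ι] [DecidableEq ι]
    {α : ι → Type*} [∀ i, MeasurableSpace (α i)] [∀ i, Add (α i)] [∀ i, MeasurableAdd (α i)]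
    {μ : ∀ i, Measure (α i)} [∀ i, SigmaFinite (μ i)]
    {f : (∀ i, α i) → ENNReal} (hf : Measurable f) (a b : ∀ i, α i)
    (h : ∀ i x, ∫⁻ y, f (Function.update x i (y + b i)) ∂μ i
      ≤ ∫⁻ y, f (Function.update x i (y + a i)) ∂μ i) :
    ∫⁻ x, f (x + b) ∂Measure.pi μ ≤ ∫⁻ x, f (x + a) ∂Measure.pi μ := by
  have hm : ∀ c : ∀ i, α i, Measurable fun x => f (x + c) := fun c =>
    hf.comp (measurable_pi_lambda _ fun i => (measurable_pi_apply i).add_const (c i))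
  -- Shifts are exchanged one by one: `b` on `s`, still `a` off `s`.
  have key : ∀ s : Finset ι, ∫⁻ x, f (x + s.piecewise b a) ∂Measure.pi μ
      ≤ ∫⁻ x, f (x + a) ∂Measure.pi μ := by
    intro s
    induction s using Finset.induction_on with
    | empty => simp
    | insert i s hi ih =>
      refine le_trans (lintegral_pi_le_of_lintegral_update_le i (hm _) (hm _) fun x => ?_) ih
      have e1 : ∀ y, Function.update x i y + (insert i s).piecewise b a
          = Function.update (x + s.piecewise b a) i (y + b i) := by
        intro y
        ext j
        by_cases hj : j = i
        · subst hj; simp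
        · simp [hj, Finset.piecewise]
      have e2 : ∀ y, Function.update x i y + s.piecewise b a
          = Function.update (x + s.piecewise b a) i (y + a i) := by
        intro y
        ext j
        by_cases hj : j = i
        · subst hj; simp [hi]
        · simp [hj, Finset.piecewise]
      simp only [e1, e2]
      exact h i _
  simpa using key Finset.univ

/-! ### Anderson's inequality on the real line -/

/-- Rearrangement inequality: with `b = a + s` and `d = c + t` the two sides differ by `s * t`. -/
theorem ENNReal.mul_add_mul_le_mul_add_mul_of_le {a b c d : ENNReal} (hab : a ≤ b) (hcd : c ≤ d) :
    a * d + b * c ≤ a * c + b * d := by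
  obtain ⟨s, rfl⟩ := exists_add_of_le hab
  obtain ⟨t, rfl⟩ := exists_add_of_le hcd
  calc a * (c + t) + (a + s) * c ≤ a * (c + t) + (a + s) * c + s * t := le_self_add
    _ = a * c + (a + s) * (c + t) := by ring

theorem gaussianPDF_zero_le_of_sq_le {v : NNReal} {x y : ℝ} (h : x ^ 2 ≤ y ^ 2) :
    gaussianPDF 0 v y ≤ gaussianPDF 0 v x := by
  refine ENNReal.ofReal_le_ofReal ?_
  simp only [gaussianPDFReal, sub_zero]
  gcongr

theorem gaussianPDF_zero_neg (v : NNReal) (x : ℝ) : gaussianPDF 0 v (-x) = gaussianPDF 0 v x := by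
  simp [gaussianPDF, gaussianPDFReal]

theorem lintegral_gaussianReal_add {v : NNReal} (hv : v ≠ 0) {φ : ℝ → ENNReal}
    (hφ : Measurable φ) (a : ℝ) :
    ∫⁻ x, φ (x + a) ∂gaussianReal 0 v = ∫⁻ x, φ x * gaussianPDF 0 v (x - a) := by
  rw [gaussianReal_of_var_ne_zero _ hv, lintegral_withDensity_eq_lintegral_mul _
    (measurable_gaussianPDF 0 v) (by fun_prop),
    ← lintegral_add_right_eq_self (fun x => φ x * gaussianPDF 0 v (x - a)) a]
  simp [mul_comm]

/-- Averaging over the reflection that exchanges the centres `a` and `b`. -/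
theorem two_mul_lintegral_gaussianReal_add {v : NNReal} (hv : v ≠ 0) {φ : ℝ → ENNReal}
    (hφ : Measurable φ) (a b : ℝ) :
    2 * ∫⁻ x, φ (x + a) ∂gaussianReal 0 v =
      ∫⁻ x, (φ x * gaussianPDF 0 v (x - a) + φ (a + b - x) * gaussianPDF 0 v (x - b)) := by
  have hp := measurable_gaussianPDF 0 v
  rw [lintegral_add_left (by fun_prop), two_mul, lintegral_gaussianReal_add hv hφ]
  congr 1
  rw [← lintegral_sub_left_eq_self _ (a + b)]
  refine lintegral_congr fun x => ?_
  rw [show a + b - x - a = -(x - b) by ring, gaussianPDF_zero_neg]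

/-- One-dimensional Anderson inequality for a centred Gaussian. -/
theorem lintegral_gaussianReal_add_mono {v : NNReal} (hv : v ≠ 0) {φ : ℝ → ENNReal}
    (hφ : Measurable φ) (hmono : ∀ x y, |x| ≤ |y| → φ x ≤ φ y) {a b : ℝ} (hab : |b| ≤ |a|) :
    ∫⁻ x, φ (x + b) ∂gaussianReal 0 v ≤ ∫⁻ x, φ (x + a) ∂gaussianReal 0 v := by
  refine (ENNReal.mul_le_mul_iff_right two_ne_zero ENNReal.ofNat_ne_top).1 ?_
  rw [two_mul_lintegral_gaussianReal_add hv hφ a b, two_mul_lintegral_gaussianReal_add hv hφ b a]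
  refine lintegral_mono fun x => ?_
  rw [add_comm b a]
  -- Since `|b| ≤ |a|`, whichever of `x` and its mirror image `a + b - x` is nearer to `a` than to
  -- `b` also has the larger modulus. Hence the values of `φ` and of the density are similarly
  -- ordered in the sum for `a`, and oppositely in the sum for `b`.
  have h : (|a + b - x| ≤ |x| ∧ (x - a) ^ 2 ≤ (x - b) ^ 2) ∨
      (|x| ≤ |a + b - x| ∧ (x - b) ^ 2 ≤ (x - a) ^ 2) := by
    simp only [← sq_le_sq]
    rcases le_total 0 a with ha | ha
    · rw [abs_of_nonneg ha, abs_le] at hab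
      rcases le_total (a + b) (2 * x) with hx | hx
      · left; constructor <;> nlinarith
      · right; constructor <;> nlinarith
    · rw [abs_of_nonpos ha, abs_le] at hab
      rcases le_total (a + b) (2 * x) with hx | hx
      · right; constructor <;> nlinarith
      · left; constructor <;> nlinarith
  rcases h with ⟨h1, h2⟩ | ⟨h1, h2⟩
  · have := ENNReal.mul_add_mul_le_mul_add_mul_of_le (hmono _ _ h1)
      (gaussianPDF_zero_le_of_sq_le (v := v) h2)
    rw [add_comm, add_comm (φ x * _)]
    exact this
  · exact ENNReal.mul_add_mul_le_mul_add_mul_of_le (hmono _ _ h1)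
      (gaussianPDF_zero_le_of_sq_le (v := v) h2)

/-! ### Complex Gaussians and diagonal forms -/

instance isProbabilityMeasure_stdComplexGaussian : IsProbabilityMeasure stdComplexGaussian :=
  Measure.isProbabilityMeasure_map (by fun_prop)

theorem lintegral_stdComplexGaussian {f : ℂ → ENNReal} (hf : Measurable f) :
    ∫⁻ z, f z ∂stdComplexGaussian =
      ∫⁻ x, ∫⁻ y, f ⟨x, y⟩ ∂gaussianReal 0 (1 / 2) ∂gaussianReal 0 (1 / 2) := by
  rw [stdComplexGaussian, lintegral_map hf (by fun_prop), lintegral_prod _ (by fun_prop)]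
  simp only [← Complex.mk_eq_add_mul_I]

/-- With one of the real and imaginary parts frozen, the integrand increases with the modulus of the
other, so the real inequality applies to each part in turn. -/
theorem lintegral_stdComplexGaussian_normSq_add_mono {φ : ℝ → ENNReal} (hφ : Monotone φ)
    {a b : ℂ} (hre : |b.re| ≤ |a.re|) (him : |b.im| ≤ |a.im|) :
    ∫⁻ z, φ (Complex.normSq (z + b)) ∂stdComplexGaussian ≤
      ∫⁻ z, φ (Complex.normSq (z + a)) ∂stdComplexGaussian := by
  have hm : Measurable φ := hφ.measurable
  have h2 : (1 / 2 : NNReal) ≠ 0 := by simp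
  have hn : Measurable Complex.normSq := Complex.continuous_normSq.measurable
  rw [lintegral_stdComplexGaussian (by fun_prop), lintegral_stdComplexGaussian (by fun_prop)]
  simp only [Complex.normSq_apply, Complex.add_re, Complex.add_im, ← sq]
  calc ∫⁻ x, ∫⁻ y, φ ((x + b.re) ^ 2 + (y + b.im) ^ 2) ∂gaussianReal 0 (1 / 2)
        ∂gaussianReal 0 (1 / 2)
      ≤ ∫⁻ x, ∫⁻ y, φ ((x + b.re) ^ 2 + (y + a.im) ^ 2) ∂gaussianReal 0 (1 / 2)
        ∂gaussianReal 0 (1 / 2) := by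
        refine lintegral_mono fun x => ?_
        refine lintegral_gaussianReal_add_mono h2 (φ := fun y => φ ((x + b.re) ^ 2 + y ^ 2))
          (by fun_prop) (fun y z hyz => hφ ?_) him
        gcongr 1
        exact sq_le_sq.2 hyz
    _ = ∫⁻ y, ∫⁻ x, φ ((x + b.re) ^ 2 + (y + a.im) ^ 2) ∂gaussianReal 0 (1 / 2)
        ∂gaussianReal 0 (1 / 2) := lintegral_lintegral_swap (by fun_prop)
    _ ≤ ∫⁻ y, ∫⁻ x, φ ((x + a.re) ^ 2 + (y + a.im) ^ 2) ∂gaussianReal 0 (1 / 2)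
        ∂gaussianReal 0 (1 / 2) := by
        refine lintegral_mono fun y => ?_
        refine lintegral_gaussianReal_add_mono h2 (φ := fun x => φ (x ^ 2 + (y + a.im) ^ 2))
          (by fun_prop) (fun x z hxz => hφ ?_) hre
        gcongr 1
        exact sq_le_sq.2 hxz
    _ = ∫⁻ x, ∫⁻ y, φ ((x + a.re) ^ 2 + (y + a.im) ^ 2) ∂gaussianReal 0 (1 / 2)
        ∂gaussianReal 0 (1 / 2) := lintegral_lintegral_swap (by fun_prop)

theorem lintegral_pi_stdComplexGaussian_diagonal_mono {ι : Type*} [Fintype ι] {φ : ℝ → ENNReal}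
    (hφ : Monotone φ) {w : ι → ℝ} (hw : ∀ i, 0 ≤ w i) {r : ℝ} (hr0 : 0 ≤ r) (hr1 : r ≤ 1)
    (d : ι → ℂ) :
    ∫⁻ z, φ (∑ i, w i * Complex.normSq (z i + r * d i))
        ∂Measure.pi (fun _ : ι => stdComplexGaussian) ≤
      ∫⁻ z, φ (∑ i, w i * Complex.normSq (z i + d i))
        ∂Measure.pi (fun _ : ι => stdComplexGaussian) := by
  classical
  have hm : Measurable φ := hφ.measurable
  have hn : Measurable Complex.normSq := Complex.continuous_normSq.measurable
  refine lintegral_pi_add_le_of_forall_update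
    (f := fun z : ι → ℂ => φ (∑ i, w i * Complex.normSq (z i))) (by fun_prop) d
    (fun i => r * d i) fun i x => ?_
  simp only [← Finset.add_sum_erase _ _ (Finset.mem_univ i), Function.update_self]
  have e : ∀ y : ℂ, ∑ j ∈ Finset.univ.erase i, w j * Complex.normSq (Function.update x i y j)
      = ∑ j ∈ Finset.univ.erase i, w j * Complex.normSq (x j) := fun y =>
    Finset.sum_congr rfl fun j hj => by rw [Function.update_of_ne (Finset.ne_of_mem_erase hj)]
  simp only [e]
  have habs : ∀ t : ℝ, |r * t| ≤ |t| := fun t => by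
    rw [abs_mul, abs_of_nonneg hr0]
    exact mul_le_of_le_one_left (abs_nonneg t) hr1
  refine lintegral_stdComplexGaussian_normSq_add_mono
    (φ := fun s => φ (w i * s + ∑ j ∈ Finset.univ.erase i, w j * Complex.normSq (x j)))
    (fun s t hst => hφ ?_) ?_ ?_
  · gcongr
    exact hw i
  · simpa using habs (d i).re
  · simpa using habs (d i).im

/-! ### Unitary invariance of the Gaussian law -/

theorem charFun_stdComplexGaussian (t : ℂ) :
    charFun stdComplexGaussian t = Complex.exp (-(‖t‖ : ℂ) ^ 2 / 4) := by
  rw [charFun_apply, stdComplexGaussian, integral_map (by fun_prop)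
    (Measurable.aestronglyMeasurable (by fun_prop))]
  have e : ∀ p : ℝ × ℝ,
      Complex.exp ((inner ℝ ((p.1 : ℂ) + (p.2 : ℂ) * Complex.I) t : ℝ) * Complex.I)
      = Complex.exp (t.re * p.1 * Complex.I) * Complex.exp (t.im * p.2 * Complex.I) := by
    intro p
    rw [← Complex.exp_add, Complex.inner]
    congr 1
    simp
    ring
  simp_rw [e]
  rw [integral_prod_mul (fun x : ℝ => Complex.exp (t.re * x * Complex.I))
    (fun x : ℝ => Complex.exp (t.im * x * Complex.I)), ← charFun_apply_real, ← charFun_apply_real,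
    charFun_gaussianReal, charFun_gaussianReal, ← Complex.exp_add]
  congr 1
  have hn : (‖t‖ : ℂ) ^ 2 = (t.re * t.re + t.im * t.im : ℝ) := by
    rw [← Complex.normSq_apply, Complex.normSq_eq_norm_sq, Complex.ofReal_pow]
  rw [hn]
  push_cast
  ring

/-- The standard complex Gaussian vector is invariant under norm-preserving linear maps. -/
theorem measurePreserving_pi_stdComplexGaussian {ι : Type*} [Fintype ι]
    (f : (ι → ℂ) →ₗ[ℂ] (ι → ℂ)) (hf : ∀ x, ∑ i, ‖f x i‖ ^ 2 = ∑ i, ‖x i‖ ^ 2) :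
    MeasurePreserving f (Measure.pi fun _ => stdComplexGaussian)
      (Measure.pi fun _ => stdComplexGaussian) := by
  have hfm : Measurable f := f.continuous_of_finiteDimensional.measurable
  refine ⟨hfm, ?_⟩
  -- The isometry is taken over `ℝ` because `charFun` uses the real inner product. Pushing forward
  -- by it moves the argument of the characteristic function by the inverse isometry, and that
  -- function depends only on the norm.
  let g : EuclideanSpace ℂ ι →ₗᵢ[ℝ] EuclideanSpace ℂ ι :=
    { toFun := fun x => WithLp.toLp 2 (f x.ofLp)
      map_add' := by intro x y; simp
      map_smul' := by
        intro c x
        ext i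
        simp
      norm_map' := by
        intro x
        rw [EuclideanSpace.norm_eq, EuclideanSpace.norm_eq]
        exact congrArg Real.sqrt (hf x.ofLp) }
  let G := g.toLinearIsometryEquiv rfl
  refine ((charFun_eq_pi_iff (μ := fun _ : ι => stdComplexGaussian)
    (ν := (Measure.pi fun _ => stdComplexGaussian).map f)).1 fun t => ?_)
  have hc : ∀ s : EuclideanSpace ℂ ι,
      charFun ((Measure.pi fun _ : ι => stdComplexGaussian).map (WithLp.toLp 2)) s
        = Complex.exp (-(‖s‖ : ℂ) ^ 2 / 4) := by
    intro s
    rw [charFun_pi]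
    simp_rw [charFun_stdComplexGaussian, ← Complex.exp_sum, ← Complex.ofReal_pow,
      EuclideanSpace.norm_sq_eq]
    simp [← Finset.sum_div]
  have h1 : ((Measure.pi fun _ : ι => stdComplexGaussian).map f).map (WithLp.toLp 2) =
      ((Measure.pi fun _ : ι => stdComplexGaussian).map (WithLp.toLp 2)).map G := by
    rw [Measure.map_map (by fun_prop) hfm, Measure.map_map G.continuous.measurable (by fun_prop)]
    rfl
  have h2 : charFun (((Measure.pi fun _ : ι => stdComplexGaussian).map (WithLp.toLp 2)).map G) t
      = charFun ((Measure.pi fun _ : ι => stdComplexGaussian).map (WithLp.toLp 2)) (G.symm t) := by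
    rw [charFun_apply, charFun_apply, integral_map G.continuous.aemeasurable
      (Measurable.aestronglyMeasurable (by fun_prop))]
    refine integral_congr_ae (ae_of_all _ fun x => ?_)
    dsimp only
    rw [← G.inner_map_map x (G.symm t), G.apply_symm_apply]
  rw [h1, h2, hc, G.symm.norm_map, ← hc t, charFun_pi]

/-- The law of a matrix with independent standard complex Gaussian entries. -/
noncomputable def stdComplexGaussianMatrix (m n : ℕ) : Measure (Fin m → Fin n → ℂ) :=
  Measure.pi fun _ => Measure.pi fun _ => stdComplexGaussian

/-- Flattening matrices to vectors makes the invariance of Gaussian vectors available for matrices.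
-/
theorem measurePreserving_curry_stdComplexGaussianMatrix (m n : ℕ) :
    MeasurePreserving (MeasurableEquiv.curry (Fin m) (Fin n) ℂ)
      (Measure.pi fun _ => stdComplexGaussian) (stdComplexGaussianMatrix m n) := by
  refine ⟨MeasurableEquiv.measurable _, ?_⟩
  have := Measure.infinitePi_map_curry (ι := Fin m) (κ := Fin n) (fun _ _ => stdComplexGaussian)
  simpa [Measure.infinitePi_eq_pi, stdComplexGaussianMatrix] using this

theorem aemeasurable_of_isStdComplexGaussianMatrix {Ω : Type*} [MeasurableSpace Ω]
    {P : Measure Ω} {m n : ℕ} {H : Ω → Matrix (Fin m) (Fin n) ℂ}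
    (hH : IsStdComplexGaussianMatrix H P) :
    AEMeasurable (fun ω i j => H ω i j) P :=
  aemeasurable_pi_lambda _ fun i => aemeasurable_pi_lambda _ fun j => (hH.hasLaw i j).aemeasurable

theorem map_eq_stdComplexGaussianMatrix {Ω : Type*} [MeasurableSpace Ω] {P : Measure Ω}
    [IsProbabilityMeasure P] {m n : ℕ} {H : Ω → Matrix (Fin m) (Fin n) ℂ}
    (hH : IsStdComplexGaussianMatrix H P) :
    P.map (fun ω i j => H ω i j) = stdComplexGaussianMatrix m n := by
  have h := (iIndepFun_iff_map_fun_eq_pi_map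
    (fun p : Fin m × Fin n => (hH.hasLaw p.1 p.2).aemeasurable)).1 hH.indep
  simp only [(hH.hasLaw _ _).map_eq] at h
  have hm : AEMeasurable (fun ω (p : Fin m × Fin n) => H ω p.1 p.2) P :=
    aemeasurable_pi_lambda _ fun p => (hH.hasLaw p.1 p.2).aemeasurable
  rw [← (measurePreserving_curry_stdComplexGaussianMatrix m n).map_eq, ← h]
  exact (AEMeasurable.map_map_of_aemeasurable
    (MeasurableEquiv.curry (Fin m) (Fin n) ℂ).measurable.aemeasurable hm).symm

/-! ### Norms, unitaries and factorization through a contraction -/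

theorem Matrix.sum_norm_sq_eq_re_dotProduct {ι : Type*} [Fintype ι] (v : ι → ℂ) :
    ∑ i, ‖v i‖ ^ 2 = (star v ⬝ᵥ v).re := by
  simp only [dotProduct, Complex.re_sum]
  refine Finset.sum_congr rfl fun i _ => ?_
  rw [← Complex.normSq_eq_norm_sq, Complex.normSq_apply]
  simp

theorem Matrix.sum_norm_sq_mulVec {ι κ : Type*} [Fintype ι] [Fintype κ] [DecidableEq ι]
    {U : Matrix κ ι ℂ} (hU : Uᴴ * U = 1) (v : ι → ℂ) :
    ∑ i, ‖(U *ᵥ v) i‖ ^ 2 = ∑ i, ‖v i‖ ^ 2 := by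
  rw [sum_norm_sq_eq_re_dotProduct, sum_norm_sq_eq_re_dotProduct, star_mulVec,
    ← dotProduct_mulVec, mulVec_mulVec, hU, one_mulVec]

theorem measurePreserving_mulVec_stdComplexGaussian {ι : Type*} [Fintype ι] [DecidableEq ι]
    {U : Matrix ι ι ℂ} (hU : Uᴴ * U = 1) :
    MeasurePreserving (fun v => U *ᵥ v) (Measure.pi fun _ : ι => stdComplexGaussian)
      (Measure.pi fun _ => stdComplexGaussian) :=
  measurePreserving_pi_stdComplexGaussian U.mulVecLin (sum_norm_sq_mulVec hU)

/-- `U` acts on each column separately, so it preserves the sum of squared moduli of all entries. -/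
theorem measurePreserving_mul_stdComplexGaussianMatrix {m n : ℕ} {U : Matrix (Fin m) (Fin m) ℂ}
    (hU : Uᴴ * U = 1) :
    MeasurePreserving (fun (G : Fin m → Fin n → ℂ) i j => (U * Matrix.of G) i j)
      (stdComplexGaussianMatrix m n) (stdComplexGaussianMatrix m n) := by
  let c := MeasurableEquiv.curry (Fin m) (Fin n) ℂ
  have hc := measurePreserving_curry_stdComplexGaussianMatrix m n
  let f : (Fin m × Fin n → ℂ) →ₗ[ℂ] (Fin m × Fin n → ℂ) :=
    { toFun := fun v p => ∑ k, U p.1 k * v (k, p.2)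
      map_add' := by intro v w; ext p; simp [mul_add, Finset.sum_add_distrib]
      map_smul' := by
        intro a v; ext p; simp only [Pi.smul_apply, smul_eq_mul, Finset.mul_sum, RingHom.id_apply]
        exact Finset.sum_congr rfl fun k _ => by ring }
  have hf : MeasurePreserving f (Measure.pi fun _ => stdComplexGaussian)
      (Measure.pi fun _ => stdComplexGaussian) := by
    refine measurePreserving_pi_stdComplexGaussian f fun x => ?_
    rw [Fintype.sum_prod_type_right, Fintype.sum_prod_type_right]
    exact Finset.sum_congr rfl fun j _ => sum_norm_sq_mulVec hU fun k => x (k, j)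
  exact (hc.comp hf).comp hc.symm

/-- Factorization of a dominated linear map through a contraction. -/
theorem LinearMap.exists_comp_eq_of_norm_le {E F G : Type*} [AddCommGroup E] [Module ℂ E]
    [NormedAddCommGroup F] [InnerProductSpace ℂ F] [FiniteDimensional ℂ F]
    [NormedAddCommGroup G] [NormedSpace ℂ G] (f : E →ₗ[ℂ] F) (g : E →ₗ[ℂ] G)
    (h : ∀ x, ‖g x‖ ≤ ‖f x‖) :
    ∃ c : LinearMap.range f →ₗ[ℂ] G, ∀ x, c ⟨f x, LinearMap.mem_range_self f x⟩ = g x := by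
  have hk : LinearMap.ker f ≤ LinearMap.ker g := fun x hx => by
    have := h x
    rw [LinearMap.mem_ker.1 hx, norm_zero] at this
    exact norm_le_zero_iff.1 this
  refine ⟨((LinearMap.ker f).liftQ g hk) ∘ₗ f.quotKerEquivRange.symm.toLinearMap, fun x => ?_⟩
  have : f.quotKerEquivRange ((LinearMap.ker f).mkQ x) = ⟨f x, LinearMap.mem_range_self f x⟩ :=
    Subtype.ext rfl
  simp [← this]

/-- The map `f x ↦ g x` is well defined and contractive on the range of `f`; orthogonal projection
onto that range extends it without raising norms. -/
theorem LinearMap.exists_contraction_comp_eq {E F : Type*} [AddCommGroup E] [Module ℂ E]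
    [NormedAddCommGroup F] [InnerProductSpace ℂ F] [FiniteDimensional ℂ F]
    (f g : E →ₗ[ℂ] F) (h : ∀ x, ‖g x‖ ≤ ‖f x‖) :
    ∃ c : F →ₗ[ℂ] F, (∀ y, ‖c y‖ ≤ ‖y‖) ∧ c ∘ₗ f = g := by
  obtain ⟨c, hc⟩ := exists_comp_eq_of_norm_le f g h
  refine ⟨c ∘ₗ (LinearMap.range f).orthogonalProjectionOnto.toLinearMap, fun y => ?_, ?_⟩
  · obtain ⟨x, hx⟩ := ((LinearMap.range f).orthogonalProjectionOnto y).2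
    have e : (LinearMap.range f).orthogonalProjectionOnto y = ⟨f x, LinearMap.mem_range_self f x⟩ :=
      Subtype.ext hx.symm
    have h1 := h x
    rw [← hc x, ← e, hx] at h1
    exact h1.trans ((LinearMap.range f).norm_orthogonalProjectionOnto_apply_le y)
  · ext x
    have e : (LinearMap.range f).orthogonalProjectionOnto (f x) = ⟨f x, LinearMap.mem_range_self f x⟩ :=
      Submodule.orthogonalProjectionOnto_mem_subspace_eq_self
        (⟨f x, LinearMap.mem_range_self f x⟩ : LinearMap.range f)
    simp [e, hc]

theorem LinearMap.exists_isometry_comp_eq {E F : Type*} [AddCommGroup E] [Module ℂ E]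
    [NormedAddCommGroup F] [InnerProductSpace ℂ F] [FiniteDimensional ℂ F]
    (f g : E →ₗ[ℂ] F) (h : ∀ x, ‖g x‖ = ‖f x‖) :
    ∃ u : F →ₗᵢ[ℂ] F, u.toLinearMap ∘ₗ f = g := by
  obtain ⟨c, hc⟩ := exists_comp_eq_of_norm_le f g fun x => (h x).le
  let L : LinearMap.range f →ₗᵢ[ℂ] F :=
    { c with
      norm_map' := by
        rintro ⟨_, x, rfl⟩
        exact (congrArg norm (hc x)).trans (h x) }
  refine ⟨L.extend, ?_⟩
  ext x
  exact (L.extend_apply ⟨f x, LinearMap.mem_range_self f x⟩).trans (hc x)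

theorem Matrix.norm_toEuclideanLin_sq {m n : ℕ} (A : Matrix (Fin m) (Fin n) ℂ)
    (x : EuclideanSpace ℂ (Fin n)) :
    ‖toEuclideanLin A x‖ ^ 2 = (star x.ofLp ⬝ᵥ ((Aᴴ * A) *ᵥ x.ofLp)).re := by
  rw [EuclideanSpace.norm_sq_eq, ← mulVec_mulVec, dotProduct_mulVec, ← star_mulVec,
    ← sum_norm_sq_eq_re_dotProduct]
  rfl

theorem Matrix.norm_toEuclideanLin_le {m n k : ℕ} {A : Matrix (Fin m) (Fin n) ℂ}
    {B : Matrix (Fin k) (Fin n) ℂ} (h : (Aᴴ * A - Bᴴ * B).PosSemidef)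
    (x : EuclideanSpace ℂ (Fin n)) : ‖toEuclideanLin B x‖ ≤ ‖toEuclideanLin A x‖ := by
  rw [← sq_le_sq₀ (norm_nonneg _) (norm_nonneg _),
    norm_toEuclideanLin_sq, norm_toEuclideanLin_sq]
  have := (Complex.le_def.1 (h.dotProduct_mulVec_nonneg x.ofLp)).1
  rw [sub_mulVec, dotProduct_sub, Complex.sub_re, Complex.zero_re] at this
  linarith

theorem Matrix.exists_unitary_mul_eq {m n : ℕ} {A B : Matrix (Fin m) (Fin n) ℂ}
    (h : Aᴴ * A = Bᴴ * B) : ∃ U : Matrix (Fin m) (Fin m) ℂ, Uᴴ * U = 1 ∧ U * A = B := by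
  obtain ⟨u, hu⟩ := LinearMap.exists_isometry_comp_eq (toEuclideanLin A) (toEuclideanLin B)
    fun x => le_antisymm (norm_toEuclideanLin_le (by simp [h, PosSemidef.zero]) x)
      (norm_toEuclideanLin_le (by simp [h, PosSemidef.zero]) x)
  have hU : toEuclideanLin (toEuclideanLin.symm u.toLinearMap) = u.toLinearMap :=
    toEuclideanLin.apply_symm_apply _
  refine ⟨toEuclideanLin.symm u.toLinearMap, ?_, ?_⟩
  · set U := toEuclideanLin.symm u.toLinearMap
    refine toEuclideanLin.injective ?_
    rw [toLpLin_mul_same, toEuclideanLin_conjTranspose_eq_adjoint, hU, toLpLin_one]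
    ext1 x
    refine ext_inner_right ℂ fun y => ?_
    rw [LinearMap.comp_apply, LinearMap.adjoint_inner_left]
    exact u.inner_map_map x y
  · refine toEuclideanLin.injective ?_
    rw [toLpLin_mul_same, hU, hu]

theorem Matrix.exists_contraction_mul_eq {m n : ℕ} {A B : Matrix (Fin m) (Fin n) ℂ}
    (h : (Aᴴ * A - Bᴴ * B).PosSemidef) :
    ∃ C : Matrix (Fin m) (Fin m) ℂ, (1 - Cᴴ * C).PosSemidef ∧ C * A = B := by
  obtain ⟨c, hc, hcA⟩ := LinearMap.exists_contraction_comp_eq (toEuclideanLin A)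
    (toEuclideanLin B) (norm_toEuclideanLin_le h)
  have hC : toEuclideanLin (toEuclideanLin.symm c) = c := toEuclideanLin.apply_symm_apply _
  refine ⟨toEuclideanLin.symm c, ?_, ?_⟩
  · set C := toEuclideanLin.symm c
    have hH : (1 - Cᴴ * C).IsHermitian := isHermitian_one.sub (isHermitian_conjTranspose_mul_self C)
    refine PosSemidef.of_dotProduct_mulVec_nonneg hH fun x => ?_
    have h1 := hc (WithLp.toLp 2 x)
    rw [← hC, ← sq_le_sq₀ (norm_nonneg _) (norm_nonneg _), norm_toEuclideanLin_sq,
      EuclideanSpace.norm_sq_eq, sum_norm_sq_eq_re_dotProduct] at h1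
    refine Complex.le_def.2 ⟨?_, (hH.im_star_dotProduct_mulVec_self x).symm⟩
    simp only [sub_mulVec, one_mulVec, dotProduct_sub, Complex.sub_re, Complex.zero_re,
      sub_nonneg]
    exact h1
  · refine toEuclideanLin.injective ?_
    rw [toLpLin_mul_same, hC, hcA]

theorem Matrix.PosSemidef.exists_eq_unitary_mul_diagonal_mul {n : ℕ} {Q : Matrix (Fin n) (Fin n) ℂ}
    (hQ : Q.PosSemidef) : ∃ (W : Matrix (Fin n) (Fin n) ℂ) (w : Fin n → ℝ), Wᴴ * W = 1 ∧
      W * Wᴴ = 1 ∧ (∀ j, 0 ≤ w j) ∧ Q = W * diagonal (fun j => (w j : ℂ)) * Wᴴ := by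
  refine ⟨hQ.1.eigenvectorUnitary.1, hQ.1.eigenvalues,
    Unitary.coe_star_mul_self hQ.1.eigenvectorUnitary,
    Unitary.coe_mul_star_self hQ.1.eigenvectorUnitary, hQ.eigenvalues_nonneg, ?_⟩
  have := hQ.1.spectral_theorem
  rwa [Unitary.conjStarAlgAut_apply] at this

/-- Singular value form of the factorization of `B` through `A` when `Bᴴ * B ≤ Aᴴ * A`. -/
theorem Matrix.exists_unitary_diagonal_unitary {m n : ℕ} {A B : Matrix (Fin m) (Fin n) ℂ}
    (h : (Aᴴ * A - Bᴴ * B).PosSemidef) :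
    ∃ (U V : Matrix (Fin m) (Fin m) ℂ) (r : Fin m → ℝ), Uᴴ * U = 1 ∧ Vᴴ * V = 1 ∧
      (∀ i, 0 ≤ r i ∧ r i ≤ 1) ∧ B = U * (diagonal (fun i => (r i : ℂ)) * (V * A)) := by
  obtain ⟨C, hC, hCA⟩ := exists_contraction_mul_eq h
  obtain ⟨W, w, hW1, hW2, hw, hspec⟩ :=
    (posSemidef_conjTranspose_mul_self C).exists_eq_unitary_mul_diagonal_mul
  -- Conjugating `1 - Cᴴ * C` by `W` gives `1 - diag(w)`, whose diagonal entries are nonnegative.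
  have hle : ∀ i, w i ≤ 1 := by
    intro i
    have h1 : (Wᴴ * (1 - Cᴴ * C) * W).PosSemidef := hC.conjTranspose_mul_mul_same W
    have h2 : Wᴴ * (1 - Cᴴ * C) * W = 1 - diagonal (fun i => (w i : ℂ)) := by
      rw [Matrix.mul_sub, Matrix.sub_mul, Matrix.mul_one, hW1, hspec]
      congr 1
      calc Wᴴ * (W * diagonal (fun i => (w i : ℂ)) * Wᴴ) * W
          = (Wᴴ * W) * diagonal (fun i => (w i : ℂ)) * (Wᴴ * W) := by
            simp only [Matrix.mul_assoc]
        _ = _ := by rw [hW1, Matrix.one_mul, Matrix.mul_one]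
    rw [h2] at h1
    have h3 := (Complex.le_def.1 (h1.diag_nonneg (i := i))).1
    simpa using h3
  have hd : (diagonal fun i => ((Real.sqrt (w i) : ℝ) : ℂ))ᴴ *
      (diagonal fun i => ((Real.sqrt (w i) : ℝ) : ℂ)) =
      diagonal (fun i => (w i : ℂ)) := by
    rw [diagonal_conjTranspose, diagonal_mul_diagonal]
    congr 1
    ext i
    simp only [Pi.star_apply, RCLike.star_def, Complex.conj_ofReal]
    rw [← Complex.ofReal_mul, Real.mul_self_sqrt (hw i)]
  -- As `W * diag(w) * Wᴴ = Cᴴ * C`, the matrix `diag(√w) * Wᴴ * A` has the same Gram matrix as `C *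
  -- A = B`, so a unitary carries it to `B`.
  obtain ⟨U, hU, hUA⟩ := exists_unitary_mul_eq
    (A := diagonal (fun i => ((Real.sqrt (w i) : ℝ) : ℂ)) * (Wᴴ * A)) (B := B) (by
      calc _ = Aᴴ * (W * ((diagonal fun i => ((Real.sqrt (w i) : ℝ) : ℂ))ᴴ *
              (diagonal fun i => ((Real.sqrt (w i) : ℝ) : ℂ))) * Wᴴ) * A := by
            simp only [conjTranspose_mul, conjTranspose_conjTranspose, Matrix.mul_assoc]
        _ = Bᴴ * B := by
            rw [hd, ← hspec, ← hCA, conjTranspose_mul]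
            simp only [Matrix.mul_assoc])
  refine ⟨U, Wᴴ, fun i => Real.sqrt (w i), hU, ?_, fun i =>
    ⟨Real.sqrt_nonneg _, ?_⟩, hUA.symm⟩
  · rwa [conjTranspose_conjTranspose]
  · exact Real.sqrt_le_one.2 (hle i)

/-! ### Anderson's inequality for quadratic forms -/

theorem Matrix.PosSemidef.exists_unitary_quadratic_form_eq {n : ℕ} {Q : Matrix (Fin n) (Fin n) ℂ}
    (hQ : Q.PosSemidef) : ∃ (W : Matrix (Fin n) (Fin n) ℂ) (w : Fin n → ℝ), Wᴴ * W = 1 ∧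
      (∀ j, 0 ≤ w j) ∧
      ∀ v : Fin n → ℂ, (star v ⬝ᵥ (Q *ᵥ v)).re = ∑ j, w j * Complex.normSq ((W *ᵥ v) j) := by
  obtain ⟨W, w, -, hW2, hw, hspec⟩ := hQ.exists_eq_unitary_mul_diagonal_mul
  refine ⟨Wᴴ, w, by rwa [conjTranspose_conjTranspose], hw, fun v => ?_⟩
  have h : star v ⬝ᵥ (Q *ᵥ v) = star (Wᴴ *ᵥ v) ⬝ᵥ
      (diagonal (fun i => (w i : ℂ)) *ᵥ (Wᴴ *ᵥ v)) := by
    conv_lhs => rw [hspec]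
    rw [star_mulVec, conjTranspose_conjTranspose, ← dotProduct_mulVec, mulVec_mulVec, mulVec_mulVec,
      Matrix.mul_assoc]
  rw [h]
  simp only [dotProduct, Complex.re_sum, mulVec_diagonal, Pi.star_apply, RCLike.star_def]
  refine Finset.sum_congr rfl fun j _ => ?_
  rw [mul_left_comm, mul_comm (starRingEnd ℂ _), Complex.mul_conj, ← Complex.ofReal_mul,
    Complex.ofReal_re]

/-- Anderson's inequality for a standard complex Gaussian vector and an ellipsoidal function. -/
theorem lintegral_pi_stdComplexGaussian_quadratic_form_mono {n : ℕ} {φ : ℝ → ENNReal}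
    (hφ : Monotone φ) {Q : Matrix (Fin n) (Fin n) ℂ} (hQ : Q.PosSemidef) {r : ℝ} (hr0 : 0 ≤ r)
    (hr1 : r ≤ 1) (d : Fin n → ℂ) :
    ∫⁻ v, φ (star (v + (r : ℂ) • d) ⬝ᵥ (Q *ᵥ (v + (r : ℂ) • d))).re
        ∂Measure.pi (fun _ : Fin n => stdComplexGaussian) ≤
      ∫⁻ v, φ (star (v + d) ⬝ᵥ (Q *ᵥ (v + d))).re
        ∂Measure.pi (fun _ : Fin n => stdComplexGaussian) := by
  obtain ⟨W, w, hW, hw, h⟩ := hQ.exists_unitary_quadratic_form_eq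
  have hm : Measurable φ := hφ.measurable
  have hn : Measurable Complex.normSq := Complex.continuous_normSq.measurable
  have hmp := measurePreserving_mulVec_stdComplexGaussian hW
  simp only [h]
  simp only [mulVec_add, mulVec_smul, Pi.add_apply, Pi.smul_apply, smul_eq_mul]
  rw [hmp.lintegral_comp (f := fun z => φ (∑ j, w j * Complex.normSq (z j + r * (W *ᵥ d) j)))
      (by fun_prop),
    hmp.lintegral_comp (f := fun z => φ (∑ j, w j * Complex.normSq (z j + (W *ᵥ d) j)))
      (by fun_prop)]
  exact lintegral_pi_stdComplexGaussian_diagonal_mono hφ hw hr0 hr1 _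

/-! ### The determinant as a function of one row -/

/-- A Gram matrix is the sum of the rank-one contributions of its rows. -/
theorem Matrix.conjTranspose_mul_self_updateRow {m n : ℕ} (A : Matrix (Fin m) (Fin n) ℂ)
    (i : Fin m) (v : Fin n → ℂ) :
    (A.updateRow i v)ᴴ * A.updateRow i v =
      (A.updateRow i 0)ᴴ * A.updateRow i 0 + vecMulVec (star v) v := by
  ext a b
  simp only [mul_apply, conjTranspose_apply, add_apply, vecMulVec_apply, Pi.star_apply,
    ← Finset.add_sum_erase _ _ (Finset.mem_univ i), updateRow_self, Pi.zero_apply, mul_zero,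
    zero_add]
  rw [add_comm]
  congr 1
  refine Finset.sum_congr rfl fun k hk => ?_
  rw [updateRow_ne (Finset.ne_of_mem_erase hk), updateRow_ne (Finset.ne_of_mem_erase hk)]

open scoped MatrixOrder in
theorem Matrix.PosSemidef.exists_eq_conjTranspose_mul_self {n : ℕ} {K : Matrix (Fin n) (Fin n) ℂ}
    (hK : K.PosSemidef) : ∃ S : Matrix (Fin n) (Fin n) ℂ, K = Sᴴ * S :=
  CStarAlgebra.nonneg_iff_eq_star_mul_self.1 hK.nonneg

/-- As a function of a single row, `det (1 + A * K * Aᴴ)` is a positive constant plus a positive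
semidefinite quadratic form. -/
theorem Matrix.PosSemidef.exists_det_one_add_updateRow_eq {m n : ℕ} {K : Matrix (Fin n) (Fin n) ℂ}
    (hK : K.PosSemidef) (A : Matrix (Fin m) (Fin n) ℂ) (i : Fin m) :
    ∃ (c : ℝ) (Q : Matrix (Fin n) (Fin n) ℂ), 0 < c ∧ Q.PosSemidef ∧ ∀ v : Fin n → ℂ,
      (1 + A.updateRow i v * K * (A.updateRow i v)ᴴ).det.re
        = c + (star v ⬝ᵥ (Q *ᵥ v)).re := by
  obtain ⟨S, rfl⟩ := hK.exists_eq_conjTranspose_mul_self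
  -- Sylvester's identity moves the determinant to size `n`, where row `i` is a rank-one
  -- perturbation of `N`; the matrix determinant lemma then gives `det N * (1 + v Sᴴ N⁻¹ S v*)`.
  let A₀ := A.updateRow i 0
  let N : Matrix (Fin n) (Fin n) ℂ := 1 + S * (A₀ᴴ * A₀) * Sᴴ
  have hN : N.PosDef := PosDef.one.add_posSemidef
    ((posSemidef_conjTranspose_mul_self A₀).mul_mul_conjTranspose_same S)
  have hdet := Complex.lt_def.1 hN.det_pos
  have hc : N.det = (N.det.re : ℂ) := Complex.ext rfl hdet.2.symm
  have hQ : ((N.det.re : ℂ) • (Sᴴ * N⁻¹ * S)).PosSemidef :=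
    (hN.inv.posSemidef.conjTranspose_mul_mul_same S).smul (hc ▸ hN.det_pos.le)
  -- The transpose appears because the row enters with the conjugate on the right.
  refine ⟨N.det.re, ((N.det.re : ℂ) • (Sᴴ * N⁻¹ * S))ᵀ, hdet.1, hQ.transpose, fun v => ?_⟩
  have h1 : (1 + A.updateRow i v * (Sᴴ * S) * (A.updateRow i v)ᴴ).det =
      (N + replicateCol Unit (S *ᵥ star v) * replicateRow Unit (v ᵥ* Sᴴ)).det := by
    have e : A.updateRow i v * (Sᴴ * S) * (A.updateRow i v)ᴴ =
        (A.updateRow i v * Sᴴ) * (S * (A.updateRow i v)ᴴ) := by simp only [Matrix.mul_assoc]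
    rw [e, det_one_add_mul_comm]
    congr 1
    have e2 : S * (A.updateRow i v)ᴴ * (A.updateRow i v * Sᴴ) =
        S * ((A.updateRow i v)ᴴ * A.updateRow i v) * Sᴴ := by simp only [Matrix.mul_assoc]
    rw [e2, conjTranspose_mul_self_updateRow, Matrix.mul_add, Matrix.add_mul, ← add_assoc,
      mul_vecMulVec, vecMulVec_mul, vecMulVec_eq Unit]
  have h2 : (replicateRow Unit (v ᵥ* Sᴴ) * N⁻¹ * replicateCol Unit (S *ᵥ star v)) default default =
      v ⬝ᵥ ((Sᴴ * N⁻¹ * S) *ᵥ star v) := by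
    rw [← mulVec_mulVec, ← mulVec_mulVec, dotProduct_mulVec, dotProduct_mulVec]
    rfl
  have h3 : (1 + replicateRow Unit (v ᵥ* Sᴴ) * N⁻¹ * replicateCol Unit (S *ᵥ star v)).det =
      1 + v ⬝ᵥ ((Sᴴ * N⁻¹ * S) *ᵥ star v) := by
    rw [det_unique, Matrix.add_apply, h2, one_apply_eq]
  have h4 : star v ⬝ᵥ (((N.det.re : ℂ) • (Sᴴ * N⁻¹ * S))ᵀ *ᵥ v) =
      N.det * (v ⬝ᵥ ((Sᴴ * N⁻¹ * S) *ᵥ star v)) := by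
    rw [mulVec_transpose, dotProduct_comm, ← dotProduct_mulVec, smul_mulVec, dotProduct_smul,
      smul_eq_mul, ← hc]
  rw [h1, det_add_replicateCol_mul_replicateRow hN.det_pos.ne'.isUnit, h3, h4, mul_add, mul_one,
    Complex.add_re]

/-! ### Bounds and invariance of the log-determinant -/

theorem Matrix.PosSemidef.exists_det_one_add_eq_prod {m : ℕ} {M : Matrix (Fin m) (Fin m) ℂ}
    (hM : M.PosSemidef) : ∃ w : Fin m → ℝ, (∀ i, 0 ≤ w i) ∧
      (1 + M).det = ∏ i, ((1 + w i : ℝ) : ℂ) ∧ M.trace = ((∑ i, w i : ℝ) : ℂ) := by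
  obtain ⟨W, w, hW1, -, hw, rfl⟩ := hM.exists_eq_unitary_mul_diagonal_mul
  refine ⟨w, hw, ?_, ?_⟩
  · rw [det_one_add_mul_comm, ← Matrix.mul_assoc, hW1, Matrix.one_mul, ← diagonal_one,
      diagonal_add, det_diagonal]
    simp
  · rw [trace_mul_comm, ← Matrix.mul_assoc, hW1, Matrix.one_mul, trace_diagonal]
    simp

theorem logDetRate_nonneg {m n : ℕ} {K : Matrix (Fin n) (Fin n) ℂ} (hK : K.PosSemidef)
    (G : Matrix (Fin m) (Fin n) ℂ) : 0 ≤ logDetRate K G := by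
  obtain ⟨w, hw, hdet, -⟩ := (hK.mul_mul_conjTranspose_same G).exists_det_one_add_eq_prod
  rw [logDetRate, hdet, ← Complex.ofReal_prod, Complex.ofReal_re]
  exact Real.log_nonneg (Finset.one_le_prod fun i _ => by linarith [hw i])

/-- Sum `log (1 + w) ≤ w` over the eigenvalues. The trace is quadratic in the entries, hence an
integrable majorant. -/
theorem logDetRate_le_trace {m n : ℕ} {K : Matrix (Fin n) (Fin n) ℂ} (hK : K.PosSemidef)
    (G : Matrix (Fin m) (Fin n) ℂ) : logDetRate K G ≤ (G * K * Gᴴ).trace.re := by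
  obtain ⟨w, hw, hdet, htr⟩ := (hK.mul_mul_conjTranspose_same G).exists_det_one_add_eq_prod
  rw [logDetRate, hdet, htr, ← Complex.ofReal_prod, Complex.ofReal_re, Complex.ofReal_re,
    Real.log_prod fun i _ => by linarith [hw i]]
  refine Finset.sum_le_sum fun i _ => ?_
  have := Real.log_le_sub_one_of_pos (x := 1 + w i) (by linarith [hw i])
  linarith

theorem logDetRate_unitary_mul {m n : ℕ} (K : Matrix (Fin n) (Fin n) ℂ)
    {U : Matrix (Fin m) (Fin m) ℂ} (hU : Uᴴ * U = 1) (G : Matrix (Fin m) (Fin n) ℂ) :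
    logDetRate K (U * G) = logDetRate K G := by
  have e : U * G * K * (U * G)ᴴ = U * (G * K * Gᴴ * Uᴴ) := by
    rw [conjTranspose_mul]; simp only [Matrix.mul_assoc]
  rw [logDetRate, e, det_one_add_mul_comm, Matrix.mul_assoc, hU, Matrix.mul_one, logDetRate]

theorem measurable_logDetRate {m n : ℕ} (K : Matrix (Fin n) (Fin n) ℂ) :
    Measurable fun G : Fin m → Fin n → ℂ => logDetRate K (Matrix.of G) := by
  have h : Continuous fun G : Matrix (Fin m) (Fin n) ℂ => (1 + G * K * Gᴴ).det.re := by fun_prop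
  have h' : Continuous fun G : Fin m → Fin n → ℂ =>
    (1 + Matrix.of G * K * (Matrix.of G)ᴴ).det.re := h
  exact Real.measurable_log.comp h'.measurable

/-! ### Monotonicity of the rate in the mean -/

/-- Attenuating the rows of the mean matrix decreases the rate. -/
theorem lintegral_logDetRate_rowScale_le {m n : ℕ} {K : Matrix (Fin n) (Fin n) ℂ}
    (hK : K.PosSemidef) {r : Fin m → ℝ} (hr : ∀ i, 0 ≤ r i ∧ r i ≤ 1)
    (D : Matrix (Fin m) (Fin n) ℂ) :
    ∫⁻ G, ENNReal.ofReal (logDetRate K (Matrix.of G + diagonal (fun i => (r i : ℂ)) * D))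
        ∂stdComplexGaussianMatrix m n ≤
      ∫⁻ G, ENNReal.ofReal (logDetRate K (Matrix.of G + D)) ∂stdComplexGaussianMatrix m n := by
  have hb : diagonal (fun i => (r i : ℂ)) * D = Matrix.of fun i => (r i : ℂ) • D i := by
    ext i j; simp [diagonal_mul]
  rw [hb]
  refine lintegral_pi_add_le_of_forall_update
    (f := fun G : Fin m → Fin n → ℂ => ENNReal.ofReal (logDetRate K (Matrix.of G)))
    (measurable_logDetRate K).ennreal_ofReal (fun i => D i) (fun i => (r i : ℂ) • D i)
    fun i x => ?_
  obtain ⟨c, Q, hc, hQ, h⟩ := hK.exists_det_one_add_updateRow_eq (Matrix.of x) i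
  -- The form is nonnegative, so `max _ 0` changes nothing; it makes the function of the form
  -- monotone on all of `ℝ`, which `Real.log` alone is not.
  have key : ∀ v : Fin n → ℂ,
      ENNReal.ofReal (logDetRate K (Matrix.of (Function.update x i v))) =
        ENNReal.ofReal (Real.log (c + max (star v ⬝ᵥ (Q *ᵥ v)).re 0)) := by
    intro v
    have hnn : 0 ≤ (star v ⬝ᵥ (Q *ᵥ v)).re :=
      (Complex.le_def.1 (hQ.dotProduct_mulVec_nonneg v)).1
    rw [max_eq_left hnn, ← h v]
    rfl
  simp only [key]
  refine lintegral_pi_stdComplexGaussian_quadratic_form_mono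
    (φ := fun t => ENNReal.ofReal (Real.log (c + max t 0))) (fun s t hst => ?_) hQ (hr i).1
    (hr i).2 (D i)
  refine ENNReal.ofReal_le_ofReal (Real.log_le_log ?_ ?_)
  · have := le_max_right s 0
    linarith
  · gcongr

theorem lintegral_logDetRate_unitary_mul {m n : ℕ} (K : Matrix (Fin n) (Fin n) ℂ)
    {U : Matrix (Fin m) (Fin m) ℂ} (hU : Uᴴ * U = 1) (D : Matrix (Fin m) (Fin n) ℂ) :
    ∫⁻ G, ENNReal.ofReal (logDetRate K (Matrix.of G + U * D)) ∂stdComplexGaussianMatrix m n =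
      ∫⁻ G, ENNReal.ofReal (logDetRate K (Matrix.of G + D)) ∂stdComplexGaussianMatrix m n := by
  have hm : Measurable fun G : Fin m → Fin n → ℂ =>
      ENNReal.ofReal (logDetRate K (Matrix.of G + U * D)) :=
    ((measurable_logDetRate K).comp
      (measurable_id.add_const (fun i j => (U * D) i j))).ennreal_ofReal
  rw [← (measurePreserving_mul_stdComplexGaussianMatrix hU).lintegral_comp hm]
  refine lintegral_congr fun G => ?_
  rw [← logDetRate_unitary_mul K hU (Matrix.of G + D), Matrix.mul_add]
  rfl

theorem lintegral_logDetRate_mono {m n : ℕ} {K : Matrix (Fin n) (Fin n) ℂ} (hK : K.PosSemidef)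
    {D D' : Matrix (Fin m) (Fin n) ℂ} (hD : (Dᴴ * D - D'ᴴ * D').PosSemidef) :
    ∫⁻ G, ENNReal.ofReal (logDetRate K (Matrix.of G + D')) ∂stdComplexGaussianMatrix m n ≤
      ∫⁻ G, ENNReal.ofReal (logDetRate K (Matrix.of G + D)) ∂stdComplexGaussianMatrix m n := by
  obtain ⟨U, V, r, hU, hV, hr, rfl⟩ := exists_unitary_diagonal_unitary hD
  -- Invariance drops `U` on the left and inserts `V` on the right; both sides now involve `V * D`.
  rw [lintegral_logDetRate_unitary_mul K hU, ← lintegral_logDetRate_unitary_mul K hV D]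
  exact lintegral_logDetRate_rowScale_le hK hr _

/-! ### Integrability and passage to expectations -/

/-- This supplies the second moments used for integrability. -/
instance isGaussian_stdComplexGaussian : IsGaussian stdComplexGaussian := by
  let L : ℝ × ℝ →L[ℝ] ℂ := Complex.equivRealProdCLM.symm
  have h : stdComplexGaussian =
      ((gaussianReal 0 (1 / 2)).prod (gaussianReal 0 (1 / 2))).map L := by
    rw [stdComplexGaussian]
    congr 1
    ext p
    simp [L, Complex.equivRealProdCLM_symm_apply]
  rw [h]
  infer_instance

theorem integrable_logDetRate_add {m n : ℕ} {Ω : Type*} [MeasurableSpace Ω] {P : Measure Ω}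
    [IsProbabilityMeasure P] {H : Ω → Matrix (Fin m) (Fin n) ℂ}
    (hH : IsStdComplexGaussianMatrix H P) (D : Matrix (Fin m) (Fin n) ℂ)
    {K : Matrix (Fin n) (Fin n) ℂ} (hK : K.PosSemidef) :
    Integrable (fun ω => logDetRate K (H ω + D)) P := by
  have hL : ∀ i j, MemLp (fun ω => H ω i j + D i j) 2 P := fun i j =>
    (hH.hasLaw i j).hasGaussianLaw.memLp_two.add (memLp_const _)
  have htr : Integrable (fun ω => ((H ω + D) * K * (H ω + D)ᴴ).trace.re) P := by
    refine Integrable.re (𝕜 := ℂ) ?_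
    simp only [trace, diag_apply, mul_apply, conjTranspose_apply, Matrix.add_apply,
      Finset.sum_mul]
    refine integrable_finsetSum _ fun i _ => integrable_finsetSum _ fun j _ =>
      integrable_finsetSum _ fun k _ => ?_
    have h := ((hL i k).integrable_mul (hL i j).star).const_mul (K k j)
    refine h.congr (ae_of_all _ fun ω => ?_)
    simp only [Pi.mul_apply, Pi.star_apply]
    ring
  have hm : AEStronglyMeasurable (fun ω => logDetRate K (H ω + D)) P :=
    (((measurable_logDetRate K).comp
      (measurable_id.add_const (fun i j => D i j))).comp_aemeasurable
        (aemeasurable_of_isStdComplexGaussianMatrix hH)).aestronglyMeasurable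
  refine htr.mono' hm (ae_of_all _ fun ω => ?_)
  rw [Real.norm_of_nonneg (logDetRate_nonneg hK _)]
  exact logDetRate_le_trace hK _

theorem ofReal_gaussianRate_eq_lintegral {m n : ℕ} {Ω : Type*} [MeasurableSpace Ω] {P : Measure Ω}
    [IsProbabilityMeasure P] {H : Ω → Matrix (Fin m) (Fin n) ℂ}
    (hH : IsStdComplexGaussianMatrix H P) (D : Matrix (Fin m) (Fin n) ℂ)
    {K : Matrix (Fin n) (Fin n) ℂ} (hK : K.PosSemidef) :
    ENNReal.ofReal (gaussianRate P H K D) =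
      ∫⁻ G, ENNReal.ofReal (logDetRate K (Matrix.of G + D)) ∂stdComplexGaussianMatrix m n := by
  have hm : Measurable fun G : Fin m → Fin n → ℂ =>
      ENNReal.ofReal (logDetRate K (Matrix.of G + D)) :=
    ((measurable_logDetRate K).comp
      (measurable_id.add_const (fun i j => D i j))).ennreal_ofReal
  rw [gaussianRate, ofReal_integral_eq_lintegral_ofReal (integrable_logDetRate_add hH D hK)
      (ae_of_all _ fun ω => logDetRate_nonneg hK _), ← map_eq_stdComplexGaussianMatrix hH,
    lintegral_map' hm.aemeasurable (aemeasurable_of_isStdComplexGaussianMatrix hH)]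
  rfl

theorem corollary1 {m n : ℕ} {Ω : Type*} [MeasurableSpace Ω] (P : Measure Ω)
    [IsProbabilityMeasure P] (H : Ω → Matrix (Fin m) (Fin n) ℂ)
    (hH : IsStdComplexGaussianMatrix H P) (D D' : Matrix (Fin m) (Fin n) ℂ)
    (hD : (Dᴴ * D - D'ᴴ * D').PosSemidef) :
    ∀ K : Matrix (Fin n) (Fin n) ℂ, K.PosSemidef →
      Integrable (fun ω => logDetRate K (H ω + D)) P ∧
      Integrable (fun ω => logDetRate K (H ω + D')) P ∧
      gaussianRate P H K D' ≤ gaussianRate P H K D := by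
  intro K hK
  refine ⟨integrable_logDetRate_add hH D hK, integrable_logDetRate_add hH D' hK, ?_⟩
  have h0 : 0 ≤ gaussianRate P H K D := integral_nonneg fun ω => logDetRate_nonneg hK _
  rw [← ENNReal.ofReal_le_ofReal_iff h0, ofReal_gaussianRate_eq_lintegral hH D hK,
    ofReal_gaussianRate_eq_lintegral hH D' hK]
  exact lintegral_logDetRate_mono hK hD
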